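/- Let $H$ be a complex Hilbert space, let $\mathcal{L}(H)$ be the space of bounded linear operators on $H$ with the operator norm, and let $S_H$ be the unit sphere of $H$. For a class $\mathcal{A}\subset\mathcal{L}(H)$ we say that $H$ has the Bishop–Phelps–Bollobás point property (BPBpp) for $\mathcal{A}$ if for every $\varepsilon>0$ there is $\eta(\varepsilon)>0$ such that, whenever $T\in\mathcal{A}$ with $\|T\|=1$ and $x_0\in S_H$ satisfy $\|Tx_0\|>1-\eta(\varepsilon)$, there is $S\in\mathcal{A}$ with $$\|S\|=1,\qquad \|Sx_0\|=1,\qquad \|S-T\|<\varepsilon .$$ For $1\le p<\infty$ the Schatten–von Neumann class $S_p(H)$ consists of all compact operators $T\in\mathcal{L}(H)$ with $\sigma_p(T)=\big(\sum_j\lambda_j^p\big)^{1/p}<\infty$, where $(\lambda_j)$ are the non-zero eigenvalues of $|T|=(T^*T)^{1/2}$ counted according to their multiplicities; the elements of the classes $S_p(H)$, $1\le p<\infty$, are called Schatten–von Neumann operators. Then: (a) $H$ has the BPBpp for positive operators; (b) $H$ has the BPBpp for positive Schatten–von Neumann operators; (c) $H$ has the BPBpp for compact positive operators; (d) $H$ has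 the BPBpp for self-adjoint Schatten–von Neumann operators; (e) $H$ has the BPBpp for normal Schatten–von Neumann operators. In (b), (d) and (e) the assertion holds both for each fixed $p\in[1,\infty)$, with $\mathcal{A}$ the set of positive (respectively self-adjoint, normal) elements of $S_p(H)$, and with $\mathcal{A}$ the set of positive (respectively self-adjoint, normal) elements of $\bigcup_{1\le p<\infty}S_p(H)$. -/

import Mathlib

open scoped ENNReal

noncomputable section

/-- The Bishop-Phelps-Bollobás point property (BPBpp) of the complex Hilbert space `H` for a class
`A` of bounded operators on `H`. The approximating operator `S` is required to lie in the same
class `A`, and it attains its norm at the given point `x₀`. -/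
def HasBPBpp {H : Type*} [NormedAddCommGroup H] [InnerProductSpace ℂ H]
    (A : Set (H →L[ℂ] H)) : Prop :=
  ∀ ε : ℝ, 0 < ε → ∃ η : ℝ, 0 < η ∧
    ∀ T ∈ A, ‖T‖ = 1 → ∀ x₀ : H, ‖x₀‖ = 1 → ‖T x₀‖ > 1 - η →
      ∃ S ∈ A, ‖S‖ = 1 ∧ ‖S x₀‖ = 1 ∧ ‖S - T‖ < ε

/-- The multiplicity of the real number `t` as an eigenvalue of `|T| = (T* T)^(1/2)`, that is, the
dimension of the eigenspace (`0` if `t` is not an eigenvalue). When `T` is compact and `t ≠ 0`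
this eigenspace is finite dimensional. -/
def singularMultiplicity {H : Type*} [NormedAddCommGroup H] [InnerProductSpace ℂ H]
    [CompleteSpace H] (T : H →L[ℂ] H) (t : ℝ) : ℕ :=
  Module.finrank ℂ
    (Module.End.eigenspace ((CFC.abs T : H →L[ℂ] H) : H →ₗ[ℂ] H) (t : ℂ))

/-- The Schatten `p`-norm of a compact operator `T`, with values in `[0, ∞]`: the `p`-th root of
the sum of the `p`-th powers of the non-zero eigenvalues of `|T|`, counted according to their
multiplicities. (As `|T|` is positive, its non-zero eigenvalues are positive real numbers.) -/
def schattenNorm {H : Type*} [NormedAddCommGroup H] [InnerProductSpace ℂ H]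
    [CompleteSpace H] (p : ℝ) (T : H →L[ℂ] H) : ℝ≥0∞ :=
  (∑' t : Set.Ioi (0 : ℝ),
    (singularMultiplicity T (t : ℝ) : ℝ≥0∞) * ENNReal.ofReal (t : ℝ) ^ p) ^ (1 / p)

/-- The Schatten-von Neumann class `S_p(H)` (used for `1 ≤ p < ∞`): the compact operators whose
Schatten `p`-norm is finite. -/
def schattenClass (H : Type*) [NormedAddCommGroup H] [InnerProductSpace ℂ H]
    [CompleteSpace H] (p : ℝ) : Set (H →L[ℂ] H) :=
  {T | IsCompactOperator T ∧ schattenNorm p T < ∞}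

/-- The operators that belong to some Schatten-von Neumann class `S_p(H)` with `1 ≤ p < ∞`. -/
def schattenOperators (H : Type*) [NormedAddCommGroup H] [InnerProductSpace ℂ H]
    [CompleteSpace H] : Set (H →L[ℂ] H) :=
  {T | ∃ p : ℝ, 1 ≤ p ∧ T ∈ schattenClass H p}

end

/-! All the classes consist of normal operators, so one construction serves. Write `c = 1 - d` and
let `f z = z / max ‖z‖ c`. Then `f(T)` is a contraction within `d` of `T`, and it is isometric on
vectors `k(T) x` whenever the cutoff `k` vanishes on `‖z‖ ≤ c`. If `‖T x₀‖` is near 1, comparing `(1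
- k)²` with `(1 - ‖z‖²) / (1 - c)` shows that `k(T) x₀` is close to `x₀`; so `f(T)` attains norm 1
at the nearby unit vector `x₁` obtained by normalising it. A unitary `e` near the identity with `e
x₁ = x₀` moves the attaining point: `S = e f(T) e⁻¹`. It only remains that each class is stable
under unitary conjugation and under `f`. For Schatten classes, `f` divides singular values below `c`
by `c` and merges the others into the value 1. -/

/-! ### Functional calculus: radial truncation and spectral cutoff. -/

section RadialTruncation

/-- The radial retraction of the complex plane that sends the annulus `c ≤ ‖z‖` to the unit circle
and is multiplication by `c⁻¹` on the disc of radius `c`. -/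
noncomputable def radialRetraction (c : ℝ) (z : ℂ) : ℂ := ((max ‖z‖ c)⁻¹ : ℝ) * z

lemma continuous_inv_max_norm {c : ℝ} (hc : 0 < c) :
    Continuous fun z : ℂ ↦ (((max ‖z‖ c)⁻¹ : ℝ) : ℂ) :=
  Complex.continuous_ofReal.comp <|
    (continuous_norm.max continuous_const).inv₀ fun _ ↦ (lt_max_of_lt_right hc).ne'

lemma continuous_radialRetraction {c : ℝ} (hc : 0 < c) : Continuous (radialRetraction c) :=
  (continuous_inv_max_norm hc).mul continuous_id

lemma norm_radialRetraction {c : ℝ} (hc : 0 < c) (z : ℂ) :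
    ‖radialRetraction c z‖ = (max ‖z‖ c)⁻¹ * ‖z‖ := by
  have : 0 ≤ max ‖z‖ c := hc.le.trans (le_max_right _ _)
  rw [radialRetraction, norm_mul, Complex.norm_real, Real.norm_of_nonneg (by positivity)]

lemma norm_radialRetraction_le_one {c : ℝ} (hc : 0 < c) (z : ℂ) : ‖radialRetraction c z‖ ≤ 1 := by
  rw [norm_radialRetraction hc, inv_mul_le_one₀ (lt_max_of_lt_right hc)]
  exact le_max_left _ _

lemma norm_radialRetraction_of_le {c : ℝ} (hc : 0 < c) {z : ℂ} (hz : c ≤ ‖z‖) :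
    ‖radialRetraction c z‖ = 1 := by
  rw [norm_radialRetraction hc, max_eq_left hz, inv_mul_cancel₀ (hc.trans_le hz).ne']

lemma norm_radialRetraction_sub_le {c : ℝ} (hc : 0 < c) (hc1 : c ≤ 1) {z : ℂ} (hz : ‖z‖ ≤ 1) :
    ‖radialRetraction c z - z‖ ≤ 1 - c := by
  have hm : 0 < max ‖z‖ c := lt_max_of_lt_right hc
  have hm1 : max ‖z‖ c ≤ 1 := max_le hz hc1
  have : radialRetraction c z - z = (((max ‖z‖ c)⁻¹ - 1 : ℝ) : ℂ) * z := by
    rw [radialRetraction]; push_cast; ring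
  rw [this, norm_mul, Complex.norm_real,
    Real.norm_of_nonneg (sub_nonneg.2 (one_le_inv₀ hm |>.2 hm1))]
  have h1 : (max ‖z‖ c)⁻¹ * ‖z‖ ≤ 1 := by
    rw [inv_mul_le_one₀ hm]; exact le_max_left _ _
  have h2 : 0 ≤ (max ‖z‖ c)⁻¹ - 1 := sub_nonneg.2 (one_le_inv₀ hm |>.2 hm1)
  calc ((max ‖z‖ c)⁻¹ - 1) * ‖z‖ ≤ ((max ‖z‖ c)⁻¹ - 1) * max ‖z‖ c := by
        gcongr; exact le_max_left _ _
    _ = 1 - max ‖z‖ c := by field_simp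
    _ ≤ 1 - c := by gcongr; exact le_max_right _ _

/-- A continuous cut-off function, vanishing on the disc of radius `c` and equal to `1` on the unit
circle. -/
noncomputable def annulusCutoff (c : ℝ) (z : ℂ) : ℂ := ((max 0 (1 - (1 - ‖z‖) / (1 - c)) : ℝ) : ℂ)

lemma continuous_annulusCutoff (c : ℝ) : Continuous (annulusCutoff c) := by
  unfold annulusCutoff
  fun_prop

lemma star_annulusCutoff (c : ℝ) (z : ℂ) : star (annulusCutoff c z) = annulusCutoff c z :=
  Complex.conj_ofReal _

lemma annulusCutoff_of_norm_le {c : ℝ} (hc : c < 1) {z : ℂ} (hz : ‖z‖ ≤ c) :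
    annulusCutoff c z = 0 := by
  have : 1 ≤ (1 - ‖z‖) / (1 - c) := by rw [one_le_div (by linarith)]; linarith
  rw [annulusCutoff, max_eq_left (by linarith), Complex.ofReal_zero]

/-- With `u = (1 - ‖z‖) / (1 - c) ≥ 0`, the left side is `(min u 1)² ≤ u`, and `1 - ‖z‖ ≤ 1 - ‖z‖²`.
-/
lemma norm_one_sub_annulusCutoff_sq_le {c : ℝ} (hc : c < 1) {z : ℂ} (hz : ‖z‖ ≤ 1) :
    ‖1 - annulusCutoff c z‖ ^ 2 ≤ (1 - ‖z‖ ^ 2) / (1 - c) := by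
  have hc' : 0 < 1 - c := by linarith
  have hz0 := norm_nonneg z
  set u : ℝ := (1 - ‖z‖) / (1 - c) with hu
  have hu0 : 0 ≤ u := div_nonneg (by linarith) hc'.le
  have hle : u ≤ (1 - ‖z‖ ^ 2) / (1 - c) := by
    rw [hu]; gcongr; nlinarith
  have h1 : (1 : ℂ) - annulusCutoff c z = ((1 - max 0 (1 - u) : ℝ) : ℂ) := by
    rw [annulusCutoff]; push_cast; rfl
  rw [h1, Complex.norm_real, Real.norm_eq_abs, sq_abs]
  refine le_trans ?_ hle
  rcases le_total u 1 with h | h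
  · rw [max_eq_right (by linarith)]; nlinarith
  · rw [max_eq_left (by linarith)]; linarith

variable {H : Type*} [NormedAddCommGroup H] [InnerProductSpace ℂ H] [CompleteSpace H]

/-- The image of a normal operator under the radial retraction. -/
noncomputable def radialTruncation (c : ℝ) (T : H →L[ℂ] H) : H →L[ℂ] H :=
  cfc (radialRetraction c) T

open ContinuousLinearMap

lemma isStarNormal_radialTruncation (c : ℝ) (T : H →L[ℂ] H) :
    IsStarNormal (radialTruncation c T) := cfc_predicate _ _

lemma isSelfAdjoint_radialTruncation (c : ℝ) {T : H →L[ℂ] H} (hT : IsSelfAdjoint T) :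
    IsSelfAdjoint (radialTruncation c T) := by
  rw [IsSelfAdjoint, radialTruncation, ← cfc_star]
  refine cfc_congr fun z hz ↦ ?_
  have : star z = z := by
    simpa using Complex.conj_eq_iff_re.2 (hT.mem_spectrum_eq_re hz).symm
  simp only [radialRetraction, star_mul', this]
  congr 1
  exact Complex.conj_ofReal _

open ComplexOrder in
lemma isPositive_radialTruncation {c : ℝ} (hc : 0 < c) {T : H →L[ℂ] H} (hT : T.IsPositive) :
    (radialTruncation c T).IsPositive := by
  rw [← nonneg_iff_isPositive] at hT ⊢
  refine cfc_nonneg fun z hz ↦ ?_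
  have hz0 : 0 ≤ z := spectrum_nonneg_of_nonneg hT hz
  refine mul_nonneg ?_ hz0
  exact_mod_cast inv_nonneg.2 (hc.le.trans (le_max_right _ _))

lemma isCompactOperator_radialTruncation {c : ℝ} (hc : 0 < c) {T : H →L[ℂ] H}
    (hn : IsStarNormal T) (hT : IsCompactOperator T) :
    IsCompactOperator (radialTruncation c T) := by
  -- Since `max ‖z‖ c ≥ c > 0`, a factor `z` splits off with continuous cofactor; compactness passes
  -- to the product.
  have : radialTruncation c T = cfc (fun z : ℂ ↦ (((max ‖z‖ c)⁻¹ : ℝ) : ℂ)) T * T := by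
    conv_rhs => enter [2]; rw [← cfc_id' ℂ T]
    rw [← cfc_mul _ _ T (continuous_inv_max_norm hc).continuousOn (continuousOn_id' _)]
    rfl
  rw [this]
  exact hT.clm_comp _

lemma norm_radialTruncation_le_one {c : ℝ} (hc : 0 < c) (T : H →L[ℂ] H) :
    ‖radialTruncation c T‖ ≤ 1 :=
  norm_cfc_le zero_le_one fun z _ ↦ norm_radialRetraction_le_one hc z

lemma norm_le_norm_of_mem_spectrum {T : H →L[ℂ] H} {z : ℂ} (hz : z ∈ spectrum ℂ T) :
    ‖z‖ ≤ ‖T‖ := by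
  rcases subsingleton_or_nontrivial H with h | h
  · simp [spectrum.of_subsingleton] at hz
  · exact spectrum.norm_le_norm_of_mem hz

lemma norm_radialTruncation_sub_le {c : ℝ} (hc : 0 < c) (hc1 : c ≤ 1) {T : H →L[ℂ] H}
    (hn : IsStarNormal T) (hT : ‖T‖ ≤ 1) : ‖radialTruncation c T - T‖ ≤ 1 - c := by
  conv_lhs => enter [1, 2]; rw [← cfc_id' ℂ T]
  rw [radialTruncation, ← cfc_sub _ _ T (continuous_radialRetraction hc).continuousOn
    (continuousOn_id' _)]
  refine norm_cfc_le (by linarith) fun z hz ↦ norm_radialRetraction_sub_le hc hc1 ?_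
  exact (norm_le_norm_of_mem_spectrum hz).trans hT

lemma norm_apply_sq_eq_re_inner (T : H →L[ℂ] H) (x : H) :
    ‖T x‖ ^ 2 = RCLike.re (inner ℂ ((star T * T) x) x) := by
  rw [star_eq_adjoint, mul_apply_eq_comp, adjoint_inner_left, inner_self_eq_norm_sq]

lemma norm_cfc_apply_sq_eq_re_inner {f : ℂ → ℂ} (hf : Continuous f) (T : H →L[ℂ] H) (x : H) :
    ‖cfc f T x‖ ^ 2 = RCLike.re (inner ℂ (cfc (fun z ↦ star (f z) * f z) T x) x) := by
  rw [norm_apply_sq_eq_re_inner, ← cfc_star,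
    ← cfc_mul _ _ T hf.star.continuousOn hf.continuousOn]

/-- The retraction has modulus 1 wherever the cutoff is nonzero, so multiplying the cutoff by it
leaves the squared modulus unchanged. -/
lemma norm_radialTruncation_apply_annulusCutoff {c : ℝ} (hc : 0 < c) (hc1 : c < 1)
    (T : H →L[ℂ] H) (x : H) :
    ‖radialTruncation c T (cfc (annulusCutoff c) T x)‖ = ‖cfc (annulusCutoff c) T x‖ := by
  have hf := continuous_radialRetraction hc
  have hk := continuous_annulusCutoff c
  rw [← sq_eq_sq₀ (norm_nonneg _) (norm_nonneg _), ← mul_apply_eq_comp, radialTruncation,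
    ← cfc_mul _ _ T hf.continuousOn hk.continuousOn, norm_cfc_apply_sq_eq_re_inner
      (f := fun z ↦ radialRetraction c z * annulusCutoff c z) (hf.mul hk),
    norm_cfc_apply_sq_eq_re_inner hk]
  congr 4
  ext z
  rcases le_total ‖z‖ c with h | h
  · simp [annulusCutoff_of_norm_le hc1 h]
  · have : star (radialRetraction c z) * radialRetraction c z = 1 := by
      rw [Complex.star_def, Complex.conj_mul', norm_radialRetraction_of_le hc h]; simp
    rw [star_mul', mul_mul_mul_comm, this, one_mul]

open ComplexOrder in
lemma norm_sub_annulusCutoff_apply_sq_le {c : ℝ} (hc1 : c < 1) {T : H →L[ℂ] H}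
    (hn : IsStarNormal T) (hT : ‖T‖ ≤ 1) (x : H) :
    ‖x - cfc (annulusCutoff c) T x‖ ^ 2 ≤ (‖x‖ ^ 2 - ‖T x‖ ^ 2) / (1 - c) := by
  have hk := (continuous_annulusCutoff c).continuousOn (s := spectrum ℂ T)
  have h1 : x - cfc (annulusCutoff c) T x = cfc (fun z ↦ 1 - annulusCutoff c z) T x := by
    rw [cfc_sub _ _ T continuousOn_const hk, cfc_const_one ℂ T]; rfl
  -- The scalar bound on the spectrum becomes an operator inequality with right side `(1 - c)⁻¹ (1 -
  -- T*T)`, then tested at `x`.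
  have hle : cfc (fun z ↦ star (1 - annulusCutoff c z) * (1 - annulusCutoff c z)) T ≤
      cfc (fun z ↦ ((1 - c)⁻¹ : ℂ) * (1 - star z * z)) T := by
    refine cfc_mono (fun z hz ↦ ?_) ?_ ?_
    · rw [Complex.star_def, Complex.conj_mul', Complex.conj_mul']
      have := norm_one_sub_annulusCutoff_sq_le hc1 ((norm_le_norm_of_mem_spectrum hz).trans hT)
      rw [div_eq_inv_mul] at this
      exact_mod_cast this
    · exact (continuousOn_const.sub hk).star.mul (continuousOn_const.sub hk)
    · fun_prop
  have h2 : cfc (fun z ↦ ((1 - c)⁻¹ : ℂ) * (1 - star z * z)) T =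
      (((1 - c)⁻¹ : ℝ) : ℂ) • (1 - star T * T) := by
    rw [cfc_const_mul _ _ T (by fun_prop), cfc_sub _ _ T (by fun_prop) (by fun_prop),
      cfc_const_one ℂ T, cfc_mul _ _ T (by fun_prop) (by fun_prop), cfc_star_id (a := T) (R := ℂ),
      cfc_id' ℂ T]
    push_cast; rfl
  rw [h1, norm_cfc_apply_sq_eq_re_inner (f := fun z ↦ 1 - annulusCutoff c z)
    (continuous_const.sub (continuous_annulusCutoff c))]
  rw [h2, le_def] at hle
  have h3 := hle.re_inner_nonneg_left x
  rw [sub_apply, inner_sub_left, map_sub, sub_nonneg] at h3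
  refine h3.trans (le_of_eq ?_)
  rw [smul_apply, sub_apply, inner_smul_left, inner_sub_left, Complex.conj_ofReal,
    RCLike.re_eq_complex_re, Complex.re_ofReal_mul, Complex.sub_re, ← RCLike.re_eq_complex_re,
    ← norm_apply_sq_eq_re_inner, one_apply_eq_self, inner_self_eq_norm_sq]
  rw [div_eq_inv_mul]

end RadialTruncation

/-! ### Unitaries near the identity and conjugation by them. -/

section Rotation

variable {H : Type*} [NormedAddCommGroup H] [InnerProductSpace ℂ H]

lemma norm_inv_norm_smul_sub_le (a : H) {b : H} (hb : ‖b‖ = 1) :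
    ‖((‖a‖⁻¹ : ℝ) : ℂ) • a - b‖ ≤ 2 * ‖a - b‖ := by
  rcases eq_or_ne a 0 with rfl | ha
  · simp [hb]
  have ha' : ‖a‖ ≠ 0 := norm_ne_zero_iff.2 ha
  have h1 : ‖((‖a‖⁻¹ : ℝ) : ℂ) • a - a‖ ≤ ‖a - b‖ := by
    have : ((‖a‖⁻¹ : ℝ) : ℂ) • a - a = ((‖a‖⁻¹ - 1 : ℝ) : ℂ) • a := by
      push_cast; rw [sub_smul, one_smul]
    rw [this, norm_smul, Complex.norm_real, Real.norm_eq_abs]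
    nth_rw 2 [← abs_of_nonneg (norm_nonneg a)]
    rw [← abs_mul, sub_mul, inv_mul_cancel₀ ha', one_mul, ← hb, abs_sub_comm]
    exact abs_norm_sub_norm_le a b
  calc ‖((‖a‖⁻¹ : ℝ) : ℂ) • a - b‖ = ‖(((‖a‖⁻¹ : ℝ) : ℂ) • a - a) + (a - b)‖ := by
        rw [sub_add_sub_cancel]
    _ ≤ _ := (norm_add_le _ _).trans (by linarith)

lemma norm_inv_norm_smul {a : H} (ha : a ≠ 0) : ‖((‖a‖⁻¹ : ℝ) : ℂ) • a‖ = 1 := by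
  rw [norm_smul, Complex.norm_real, norm_inv, norm_norm, inv_mul_cancel₀ (norm_ne_zero_iff.2 ha)]

lemma reflection_span_singleton_of_norm_eq_one {u : H} (hu : ‖u‖ = 1) (v : H) :
    (ℂ ∙ u).reflection v = (2 : ℂ) • inner ℂ u v • u - v := by
  rw [Submodule.reflection_singleton_apply, hu]
  simp [two_smul]

lemma norm_reflection_sub_reflection_le {u w : H} (hu : ‖u‖ = 1) (hw : ‖w‖ = 1) (v : H) :
    ‖(ℂ ∙ u).reflection v - (ℂ ∙ w).reflection v‖ ≤ 4 * ‖u - w‖ * ‖v‖ := by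
  rw [reflection_span_singleton_of_norm_eq_one hu, reflection_span_singleton_of_norm_eq_one hw,
    sub_sub_sub_cancel_right, ← smul_sub]
  have : inner ℂ u v • u - inner ℂ w v • w =
      inner ℂ (u - w) v • u + inner ℂ w v • (u - w) := by
    rw [inner_sub_left, sub_smul, smul_sub]; abel
  rw [this, norm_smul]
  have h1 : ‖inner ℂ (u - w) v • u‖ ≤ ‖u - w‖ * ‖v‖ := by
    rw [norm_smul, hu, mul_one]; exact norm_inner_le_norm _ _
  have h2 : ‖inner ℂ w v • (u - w)‖ ≤ ‖u - w‖ * ‖v‖ := by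
    rw [norm_smul, mul_comm]
    gcongr
    simpa [hw] using norm_inner_le_norm (𝕜 := ℂ) w v
  have h3 := norm_add_le (inner ℂ (u - w) v • u) (inner ℂ w v • (u - w))
  rw [Complex.norm_ofNat]
  linarith

/-- Two unit vectors with real inner product that are not opposite are related by a unitary operator
whose distance to the identity is controlled by the distance of the vectors. -/
lemma exists_linearIsometryEquiv_near_id {x y : H} (hx : ‖x‖ = 1) (hy : ‖y‖ = 1)
    (hxy : inner ℂ y x = inner ℂ x y) (hne : x + y ≠ 0) :
    ∃ e : H ≃ₗᵢ[ℂ] H, e x = y ∧ ∀ v, ‖e v - v‖ ≤ 4 * ‖x - y‖ * ‖v‖ := by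
  set m : H := ((‖x + y‖⁻¹ : ℝ) : ℂ) • (x + y) with hm
  have hm1 : ‖m‖ = 1 := norm_inv_norm_smul hne
  have hmx : ‖m - x‖ ≤ ‖x - y‖ := by
    -- The midpoint is at distance `‖x - y‖ / 2` from `x`, which absorbs the factor 2 lost in
    -- normalising.
    have h := norm_inv_norm_smul_sub_le ((2⁻¹ : ℂ) • (x + y)) hx
    have h2 : ((‖(2⁻¹ : ℂ) • (x + y)‖⁻¹ : ℝ) : ℂ) • (2⁻¹ : ℂ) • (x + y) = m := by
      rw [hm, norm_smul, smul_smul]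
      congr 1
      simp
    have h3 : (2⁻¹ : ℂ) • (x + y) - x = (2⁻¹ : ℂ) • (y - x) := by module
    rw [h2, h3, norm_smul, norm_sub_rev y x] at h
    simp at h
    linarith
  -- The first reflection fixes `x`, the second, in the bisecting line, sends it to `y`. Two
  -- reflections in nearby lines almost cancel; one alone would be far from the identity.
  refine ⟨(ℂ ∙ x).reflection.trans (ℂ ∙ m).reflection, ?_, fun v ↦ ?_⟩
  · rw [LinearIsometryEquiv.trans_apply, Submodule.reflection_mem_subspace_eq_self
      (Submodule.mem_span_singleton_self x), reflection_span_singleton_of_norm_eq_one hm1]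
    -- Here the symmetry `hxy` of the inner product is essential.
    have hnorm : ((‖x + y‖ : ℂ)) ^ 2 = 2 * inner ℂ (x + y) x := by
      have := inner_self_eq_norm_sq_to_K (𝕜 := ℂ) (x + y)
      have hxx := inner_self_eq_norm_sq_to_K (𝕜 := ℂ) x
      have hyy := inner_self_eq_norm_sq_to_K (𝕜 := ℂ) y
      rw [hx] at hxx
      rw [hy] at hyy
      simp only [inner_add_left, inner_add_right, hxx, hyy, hxy] at this ⊢
      simp only [Complex.coe_algebraMap] at this
      rw [← this]; push_cast; ring
    have h0 : ((‖x + y‖ : ℂ)) ^ 2 ≠ 0 := by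
      exact_mod_cast pow_ne_zero 2 (norm_ne_zero_iff.2 hne)
    rw [hm, inner_smul_left, Complex.conj_ofReal, smul_smul, smul_smul]
    have h2 : 2 * (((‖x + y‖⁻¹ : ℝ) : ℂ) * inner ℂ (x + y) x) * ((‖x + y‖⁻¹ : ℝ) : ℂ) = 1 := by
      push_cast
      rw [mul_left_comm, ← hnorm]
      have : (‖x + y‖ : ℂ) ≠ 0 := fun h ↦ h0 (by rw [h, zero_pow two_ne_zero])
      field_simp
    rw [h2, one_smul, add_sub_cancel_left]
  · rw [LinearIsometryEquiv.trans_apply]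
    calc _ = ‖(ℂ ∙ m).reflection ((ℂ ∙ x).reflection v) -
          (ℂ ∙ x).reflection ((ℂ ∙ x).reflection v)‖ := by rw [Submodule.reflection_reflection]
      _ ≤ 4 * ‖m - x‖ * ‖(ℂ ∙ x).reflection v‖ := norm_reflection_sub_reflection_le hm1 hx _
      _ ≤ _ := by rw [LinearIsometryEquiv.norm_map]; gcongr

variable [CompleteSpace H]

lemma norm_conjStarAlgEquiv_sub_le (e : H ≃ₗᵢ[ℂ] H) {r : ℝ} (hr : 0 ≤ r)
    (he : ∀ v, ‖e v - v‖ ≤ r * ‖v‖) {T : H →L[ℂ] H} (hT : ‖T‖ ≤ 1) :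
    ‖e.conjStarAlgEquiv T - T‖ ≤ 2 * r := by
  refine ContinuousLinearMap.opNorm_le_bound _ (by positivity) fun v ↦ ?_
  have hTv (w : H) : ‖T w‖ ≤ ‖w‖ := by simpa using T.le_of_opNorm_le hT w
  have h1 : ‖e (T (e.symm v)) - T (e.symm v)‖ ≤ r * ‖v‖ := by
    refine (he _).trans ?_
    gcongr
    exact (hTv _).trans_eq (e.symm.norm_map v)
  have h2 : ‖T (e.symm v) - T v‖ ≤ r * ‖v‖ := by
    rw [← map_sub]
    refine (hTv _).trans ?_
    have := he (e.symm v)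
    rwa [e.apply_symm_apply, e.symm.norm_map, norm_sub_rev] at this
  calc ‖(e.conjStarAlgEquiv T - T) v‖
      = ‖(e (T (e.symm v)) - T (e.symm v)) + (T (e.symm v) - T v)‖ := by
        rw [sub_add_sub_cancel]; rfl
    _ ≤ 2 * r * ‖v‖ := (norm_add_le _ _).trans (by linarith)

lemma ContinuousLinearMap.IsPositive.conjStarAlgEquiv {T : H →L[ℂ] H} (hT : T.IsPositive)
    (e : H ≃ₗᵢ[ℂ] H) : (e.conjStarAlgEquiv T).IsPositive := by
  rw [← ContinuousLinearMap.nonneg_iff_isPositive] at hT ⊢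
  exact map_nonneg e.conjStarAlgEquiv hT

lemma IsCompactOperator.conjStarAlgEquiv {T : H →L[ℂ] H} (hT : IsCompactOperator T)
    (e : H ≃ₗᵢ[ℂ] H) : IsCompactOperator (e.conjStarAlgEquiv T) :=
  (hT.comp_clm (e.symm : H →L[ℂ] H)).clm_comp (e : H →L[ℂ] H)

/-- Both sides are positive square roots of the same operator. -/
lemma abs_conjStarAlgEquiv (e : H ≃ₗᵢ[ℂ] H) (T : H →L[ℂ] H) :
    CFC.abs (e.conjStarAlgEquiv T) = e.conjStarAlgEquiv (CFC.abs T) := by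
  refine CFC.sqrt_unique ?_ (map_nonneg e.conjStarAlgEquiv (CFC.abs_nonneg T))
  rw [← map_mul, CFC.abs_mul_abs, map_mul, map_star]

lemma singularMultiplicity_conjStarAlgEquiv (e : H ≃ₗᵢ[ℂ] H) (T : H →L[ℂ] H) (t : ℝ) :
    singularMultiplicity (e.conjStarAlgEquiv T) t = singularMultiplicity T t := by
  rw [singularMultiplicity, singularMultiplicity, abs_conjStarAlgEquiv]
  refine Eq.trans ?_ (e.toLinearEquiv.finrank_map_eq _)
  refine congrArg (fun E : Submodule ℂ H ↦ Module.finrank ℂ E) ?_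
  ext v
  simp only [Submodule.mem_map_equiv, Module.End.mem_eigenspace_iff]
  change e (CFC.abs T (e.symm v)) = (t : ℂ) • v ↔ CFC.abs T (e.symm v) = (t : ℂ) • e.symm v
  rw [← e.symm.map_smul, ← e.symm.injective.eq_iff, e.symm_apply_apply]

lemma conjStarAlgEquiv_mem_schattenClass {p : ℝ} (e : H ≃ₗᵢ[ℂ] H) {T : H →L[ℂ] H}
    (hT : T ∈ schattenClass H p) : e.conjStarAlgEquiv T ∈ schattenClass H p := by
  refine ⟨hT.1.conjStarAlgEquiv e, ?_⟩
  have := hT.2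
  simpa only [schattenNorm, singularMultiplicity_conjStarAlgEquiv] using this

end Rotation

/-! ### Schatten classes are stable under radial truncation. -/

section SchattenTruncation

variable {H : Type*} [NormedAddCommGroup H] [InnerProductSpace ℂ H] [CompleteSpace H]

lemma abs_eq_cfc_complex_norm {T : H →L[ℂ] H} (hn : IsStarNormal T) :
    CFC.abs T = cfc (fun z : ℂ ↦ (‖z‖ : ℂ)) T := by
  rw [CFC.abs_eq_cfcₙ_coe_norm ℂ T hn, cfcₙ_eq_cfc]
  rfl

lemma abs_radialTruncation {c : ℝ} (hc : 0 < c) {T : H →L[ℂ] H} (hn : IsStarNormal T) :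
    CFC.abs (radialTruncation c T) = cfc (fun z : ℂ ↦ (‖radialRetraction c z‖ : ℂ)) T := by
  rw [abs_eq_cfc_complex_norm (isStarNormal_radialTruncation c T), radialTruncation,
    ← cfc_comp' (fun z : ℂ ↦ (‖z‖ : ℂ)) (radialRetraction c) T (by fun_prop)
      (continuous_radialRetraction hc).continuousOn]

/-- Each of `f - a` and `g - b` is a continuous multiple of the other, so the corresponding
operators have the same kernel. -/
lemma eigenspace_cfc_eq_of_mul_eq {f g q r : ℂ → ℂ} {a b : ℂ} (T : H →L[ℂ] H)
    (hn : IsStarNormal T) (hf : Continuous f) (hg : Continuous g)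
    (hq : Continuous q) (hr : Continuous r)
    (h₁ : ∀ z, f z - a = q z * (g z - b)) (h₂ : ∀ z, g z - b = r z * (f z - a)) :
    Module.End.eigenspace ((cfc f T : H →L[ℂ] H) : H →ₗ[ℂ] H) a =
      Module.End.eigenspace ((cfc g T : H →L[ℂ] H) : H →ₗ[ℂ] H) b := by
  have key {f g q : ℂ → ℂ} {a b : ℂ} (hf : Continuous f) (hg : Continuous g) (hq : Continuous q)
      (h : ∀ z, f z - a = q z * (g z - b)) {v : H} (hv : cfc g T v = b • v) :
      cfc f T v = a • v := by
    have hsub {f : ℂ → ℂ} {a : ℂ} (hf : Continuous f) :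
        cfc (fun z ↦ f z - a) T v = cfc f T v - a • v := by
      rw [cfc_sub _ _ T hf.continuousOn continuousOn_const, cfc_const a T,
        Algebra.algebraMap_eq_smul_one]
      rfl
    rw [← sub_eq_zero, ← hsub hf]
    simp_rw [h]
    rw [cfc_mul q (fun z ↦ g z - b) T hq.continuousOn (hg.sub continuous_const).continuousOn,
      mul_apply_eq_comp, hsub hg, hv, sub_self, map_zero]
  ext v
  simp only [Module.End.mem_eigenspace_iff, ContinuousLinearMap.coe_coe]
  exact ⟨key hg hf hr h₂, key hf hg hq h₁⟩

lemma singularMultiplicity_radialTruncation {c t : ℝ} (hc : 0 < c) (ht1 : t < 1)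
    {T : H →L[ℂ] H} (hn : IsStarNormal T) :
    singularMultiplicity (radialTruncation c T) t = singularMultiplicity T (c * t) := by
  rw [singularMultiplicity, singularMultiplicity, abs_radialTruncation hc hn,
    abs_eq_cfc_complex_norm hn]
  have hd (z : ℂ) : 0 < max ‖z‖ c - c * t := by nlinarith [le_max_right ‖z‖ c]
  have hm (z : ℂ) : 0 < max ‖z‖ c := lt_max_of_lt_right hc
  have ht : 0 < 1 - t := sub_pos.2 ht1
  -- For `t < 1` both `‖f z‖ - t` and `‖z‖ - c t` vanish on the same circle, and their ratio is
  -- continuous and positive.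
  have key (z : ℂ) : (max ‖z‖ c - c * t) * (‖radialRetraction c z‖ - t) =
      (1 - t) * (‖z‖ - c * t) := by
    rw [norm_radialRetraction hc]
    rcases le_total ‖z‖ c with h | h
    · rw [max_eq_right h]; field_simp
    · rw [max_eq_left h, inv_mul_cancel₀ (hc.trans_le h).ne']; ring
  have hcont : Continuous fun z : ℂ ↦ max ‖z‖ c - c * t := by fun_prop
  refine congrArg (fun E : Submodule ℂ H ↦ Module.finrank ℂ E) (eigenspace_cfc_eq_of_mul_eq
    (q := fun z ↦ (((1 - t) / (max ‖z‖ c - c * t) : ℝ) : ℂ))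
    (r := fun z ↦ (((max ‖z‖ c - c * t) / (1 - t) : ℝ) : ℂ)) T hn ?_ ?_ ?_ ?_
    (fun z ↦ ?_) (fun z ↦ ?_))
  · exact Complex.continuous_ofReal.comp (continuous_radialRetraction hc).norm
  · fun_prop
  · exact Complex.continuous_ofReal.comp (continuous_const.div hcont fun z ↦ (hd z).ne')
  · exact Complex.continuous_ofReal.comp (hcont.div_const _)
  · have : ‖radialRetraction c z‖ - t =
        (1 - t) / (max ‖z‖ c - c * t) * (‖z‖ - c * t) := by
      rw [div_mul_eq_mul_div, eq_div_iff (hd z).ne', mul_comm, key]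
    exact_mod_cast this
  · have : ‖z‖ - c * t = (max ‖z‖ c - c * t) / (1 - t) * (‖radialRetraction c z‖ - t) := by
      rw [div_mul_eq_mul_div, eq_div_iff ht.ne', key, mul_comm]
    exact_mod_cast this

lemma singularMultiplicity_eq_zero_of_norm_lt {T : H →L[ℂ] H} {t : ℝ} (ht : ‖T‖ < t) :
    singularMultiplicity T t = 0 := by
  have : Module.End.eigenspace ((CFC.abs T : H →L[ℂ] H) : H →ₗ[ℂ] H) (t : ℂ) = ⊥ := by
    rw [eq_bot_iff]
    intro v hv
    rw [Module.End.mem_eigenspace_iff, ContinuousLinearMap.coe_coe] at hv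
    have h := (CFC.abs T).le_opNorm v
    rw [hv, CFC.norm_abs, norm_smul, Complex.norm_real,
      Real.norm_of_nonneg ((norm_nonneg T).trans ht.le)] at h
    rw [Submodule.mem_bot, ← norm_le_zero_iff]
    nlinarith [norm_nonneg v]
  rw [singularMultiplicity, this, finrank_bot]

lemma schattenNorm_lt_top_iff {p : ℝ} (hp : 0 < p) (T : H →L[ℂ] H) :
    schattenNorm p T < ∞ ↔ (∑' t : Set.Ioi (0 : ℝ),
      (singularMultiplicity T (t : ℝ) : ℝ≥0∞) * ENNReal.ofReal (t : ℝ) ^ p) < ∞ := by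
  rw [schattenNorm, ENNReal.rpow_lt_top_iff_of_pos (by positivity)]

lemma radialTruncation_mem_schattenClass {p c : ℝ} (hp : 0 < p) (hc : 0 < c)
    {T : H →L[ℂ] H} (hn : IsStarNormal T) (hT : T ∈ schattenClass H p) :
    radialTruncation c T ∈ schattenClass H p := by
  refine ⟨isCompactOperator_radialTruncation hc hn hT.1, ?_⟩
  have hsum := (schattenNorm_lt_top_iff hp T).1 hT.2
  rw [schattenNorm_lt_top_iff hp]
  set F : Set.Ioi (0 : ℝ) → ℝ≥0∞ := fun t ↦
    (singularMultiplicity T (t : ℝ) : ℝ≥0∞) * ENNReal.ofReal (t : ℝ) ^ p with hF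
  let φ : Set.Ioi (0 : ℝ) → Set.Ioi (0 : ℝ) := fun t ↦ ⟨c * t, mul_pos hc t.2⟩
  have hφ : Function.Injective φ := fun s t h ↦
    Subtype.ext (mul_left_cancel₀ hc.ne' (congrArg Subtype.val h))
  let o : Set.Ioi (0 : ℝ) := ⟨1, Set.mem_Ioi.2 one_pos⟩
  set m : ℝ≥0∞ := ((singularMultiplicity (radialTruncation c T) 1 : ℕ) : ℝ≥0∞)
  let G : Set.Ioi (0 : ℝ) → ℝ≥0∞ := Pi.single o m
  set K : ℝ≥0∞ := ENNReal.ofReal c⁻¹ ^ p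
  -- Below 1, rescaling by `c` recovers a term for `T` at cost `K`; the value 1 contributes one
  -- finite term `m`; above 1 there is nothing.
  have hle (t : Set.Ioi (0 : ℝ)) :
      (singularMultiplicity (radialTruncation c T) (t : ℝ) : ℝ≥0∞) *
        ENNReal.ofReal (t : ℝ) ^ p ≤ G t + K * F (φ t) := by
    rcases lt_trichotomy (t : ℝ) 1 with h | h | h
    · refine le_add_left (le_of_eq ?_)
      rw [singularMultiplicity_radialTruncation hc h hn, hF, mul_left_comm,
        ← ENNReal.mul_rpow_of_nonneg _ _ hp.le, ← ENNReal.ofReal_mul (inv_nonneg.2 hc.le)]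
      change _ = _ * ENNReal.ofReal (c⁻¹ * (c * t)) ^ p
      rw [inv_mul_cancel_left₀ hc.ne']
    · obtain rfl : t = o := Subtype.ext h
      refine le_add_right (le_of_eq ?_)
      simp [G, o, m]
    · rw [singularMultiplicity_eq_zero_of_norm_lt ((norm_radialTruncation_le_one hc T).trans_lt h)]
      simp
  calc _ ≤ ∑' t, (G t + K * F (φ t)) := ENNReal.tsum_le_tsum hle
    _ = m + K * ∑' t, F (φ t) := by
      rw [ENNReal.tsum_add, ENNReal.tsum_mul_left, tsum_pi_single]
    _ ≤ m + K * ∑' t, F t := by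
      gcongr m + K * ?_; exact ENNReal.tsum_comp_le_tsum_of_injective hφ F
    _ < ∞ := ENNReal.add_lt_top.2 ⟨ENNReal.natCast_lt_top _,
      ENNReal.mul_lt_top (ENNReal.rpow_lt_top_of_nonneg hp.le ENNReal.ofReal_ne_top) hsum⟩

end SchattenTruncation

/-! ### The general criterion and its Schatten version. -/

section BishopPhelpsBollobas

variable {H : Type*} [NormedAddCommGroup H] [InnerProductSpace ℂ H] [CompleteSpace H]

/-- A class of normal operators that is stable under unitary conjugation and under radial
truncations has the Bishop-Phelps-Bollobás point property. -/
theorem HasBPBpp.of_isStarNormal {A : Set (H →L[ℂ] H)} (hA : ∀ T ∈ A, IsStarNormal T)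
    (hconj : ∀ T ∈ A, ∀ e : H ≃ₗᵢ[ℂ] H, e.conjStarAlgEquiv T ∈ A)
    (htrunc : ∀ T ∈ A, ∀ c : ℝ, 0 < c → radialTruncation c T ∈ A) : HasBPBpp A := by
  intro ε hε
  obtain ⟨d, hd0, hdε, hd1⟩ : ∃ d : ℝ, 0 < d ∧ 2 * d ≤ ε ∧ d < 1 :=
    ⟨min (ε / 2) (1 / 2), by positivity, by linarith [min_le_left (ε / 2) (1 / 2 : ℝ)],
      by linarith [min_le_right (ε / 2) (1 / 2 : ℝ)]⟩
  -- This gives `‖x₀ - y‖² < 2 (d / 32)² < (d / 16)²`, hence `‖x₁ - x₀‖ < d / 8`. Conjugation then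
  -- costs less than `2 * 4 * (d / 8) = d` and truncation at most `d`, in total less than `2 * d ≤
  -- ε`.
  refine ⟨d * (d / 32) ^ 2, by positivity, fun T hT hT1 x₀ hx₀ hTx ↦ ?_⟩
  have hn := hA T hT
  set c : ℝ := 1 - d with hc
  have hc0 : 0 < c := by linarith
  have hc1 : c < 1 := by linarith
  set y : H := cfc (annulusCutoff c) T x₀ with hy
  have hyx : ‖x₀ - y‖ < d / 16 := by
    refine lt_of_pow_lt_pow_left₀ 2 (by positivity) ?_
    refine (norm_sub_annulusCutoff_apply_sq_le hc1 hn hT1.le x₀).trans_lt ?_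
    rw [hx₀, hc, sub_sub_cancel, div_lt_iff₀ hd0]
    nlinarith [sq_nonneg (‖T x₀‖ - 1), mul_pos hd0 (pow_pos hd0 2)]
  have hy0 : y ≠ 0 := by
    rintro h
    rw [h, sub_zero, hx₀] at hyx
    linarith
  set x₁ : H := ((‖y‖⁻¹ : ℝ) : ℂ) • y with hx₁
  have hx₁1 : ‖x₁‖ = 1 := norm_inv_norm_smul hy0
  have hx₁x : ‖x₁ - x₀‖ < d / 8 := by
    have := norm_inv_norm_smul_sub_le y hx₀
    rw [norm_sub_rev y] at this
    linarith
  have hSx₁ : ‖radialTruncation c T x₁‖ = 1 := by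
    rw [hx₁, map_smul, norm_smul, norm_radialTruncation_apply_annulusCutoff hc0 hc1, ← norm_smul]
    exact hx₁1
  -- The cutoff is real-valued, so its operator is self-adjoint and `⟪x₀, x₁⟫` is real.
  have hreal : inner ℂ x₀ x₁ = inner ℂ x₁ x₀ := by
    have hsa : star (cfc (annulusCutoff c) T) = cfc (annulusCutoff c) T := by
      rw [← cfc_star]
      exact cfc_congr fun z _ ↦ star_annulusCutoff c z
    rw [hx₁, inner_smul_left, inner_smul_right, Complex.conj_ofReal, hy,
      ← ContinuousLinearMap.adjoint_inner_left, ← ContinuousLinearMap.star_eq_adjoint, hsa]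
  have hne : x₁ + x₀ ≠ 0 := by
    intro h
    rw [eq_neg_of_add_eq_zero_left h, ← neg_add', norm_neg, ← two_smul ℂ, norm_smul, hx₀] at hx₁x
    simp at hx₁x
    linarith
  obtain ⟨e, hex, he⟩ := exists_linearIsometryEquiv_near_id hx₁1 hx₀ hreal hne
  have hle := norm_radialTruncation_le_one hc0 T
  have hx : ‖e.conjStarAlgEquiv (radialTruncation c T) x₀‖ = 1 := by
    rw [LinearIsometryEquiv.conjStarAlgEquiv_apply_apply, ← hex, e.symm_apply_apply, e.norm_map,
      hSx₁]
  have hclose := norm_conjStarAlgEquiv_sub_le e (by positivity) he hle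
  have hle' : ‖e.conjStarAlgEquiv (radialTruncation c T)‖ ≤ 1 := by
    refine ContinuousLinearMap.opNorm_le_bound _ zero_le_one fun v ↦ ?_
    rw [LinearIsometryEquiv.conjStarAlgEquiv_apply_apply, e.norm_map, ← e.symm.norm_map v]
    exact ContinuousLinearMap.le_of_opNorm_le _ hle _
  refine ⟨e.conjStarAlgEquiv (radialTruncation c T), hconj _ (htrunc T hT c hc0) e,
    le_antisymm hle' ?_, hx, ?_⟩
  · have := (e.conjStarAlgEquiv (radialTruncation c T)).le_opNorm x₀
    rwa [hx, hx₀, mul_one] at this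
  · have h1 := norm_radialTruncation_sub_le hc0 hc1.le hn hT1.le
    have h2 := norm_sub_le_norm_sub_add_norm_sub (e.conjStarAlgEquiv (radialTruncation c T))
      (radialTruncation c T) T
    linarith

theorem HasBPBpp.inter_of_isStarNormal {P A : Set (H →L[ℂ] H)} (hP : ∀ T ∈ P, IsStarNormal T)
    (hPconj : ∀ T ∈ P, ∀ e : H ≃ₗᵢ[ℂ] H, e.conjStarAlgEquiv T ∈ P)
    (hPtrunc : ∀ T ∈ P, ∀ c : ℝ, 0 < c → radialTruncation c T ∈ P)
    (hAconj : ∀ T ∈ A, ∀ e : H ≃ₗᵢ[ℂ] H, e.conjStarAlgEquiv T ∈ A)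
    (hAtrunc : ∀ T ∈ A, IsStarNormal T → ∀ c : ℝ, 0 < c → radialTruncation c T ∈ A) :
    HasBPBpp {T : H →L[ℂ] H | T ∈ P ∧ T ∈ A} :=
  .of_isStarNormal (fun T hT ↦ hP T hT.1)
    (fun T hT e ↦ ⟨hPconj T hT.1 e, hAconj T hT.2 e⟩)
    (fun T hT c hc ↦ ⟨hPtrunc T hT.1 c hc, hAtrunc T hT.2 (hP T hT.1) c hc⟩)

theorem HasBPBpp.schatten {P : Set (H →L[ℂ] H)} (hP : ∀ T ∈ P, IsStarNormal T)
    (hPconj : ∀ T ∈ P, ∀ e : H ≃ₗᵢ[ℂ] H, e.conjStarAlgEquiv T ∈ P)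
    (hPtrunc : ∀ T ∈ P, ∀ c : ℝ, 0 < c → radialTruncation c T ∈ P) :
    (∀ p : ℝ, 1 ≤ p → HasBPBpp {T : H →L[ℂ] H | T ∈ P ∧ T ∈ schattenClass H p}) ∧
      HasBPBpp {T : H →L[ℂ] H | T ∈ P ∧ T ∈ schattenOperators H} := by
  refine ⟨fun p hp ↦ .inter_of_isStarNormal hP hPconj hPtrunc ?_ ?_,
    .inter_of_isStarNormal hP hPconj hPtrunc ?_ ?_⟩
  · exact fun T hT e ↦ conjStarAlgEquiv_mem_schattenClass e hT
  · exact fun T hT hn c hc ↦ radialTruncation_mem_schattenClass (by linarith) hc hn hT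
  · exact fun T ⟨p, hp, hT⟩ e ↦ ⟨p, hp, conjStarAlgEquiv_mem_schattenClass e hT⟩
  · exact fun T ⟨p, hp, hT⟩ hn c hc ↦
      ⟨p, hp, radialTruncation_mem_schattenClass (by linarith) hc hn hT⟩

end BishopPhelpsBollobas

/-- The items (b), (d), (e) about Schatten-von Neumann operators are stated both for each single
class `S_p(H)` with `1 ≤ p < ∞` and for the union of these classes. -/
theorem proposition3p2 {H : Type*} [NormedAddCommGroup H] [InnerProductSpace ℂ H]
    [CompleteSpace H] :
    -- (a) positive operators
    HasBPBpp {T : H →L[ℂ] H | T.IsPositive} ∧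
    -- (b) positive Schatten-von Neumann operators
    ((∀ p : ℝ, 1 ≤ p → HasBPBpp {T : H →L[ℂ] H | T.IsPositive ∧ T ∈ schattenClass H p}) ∧
      HasBPBpp {T : H →L[ℂ] H | T.IsPositive ∧ T ∈ schattenOperators H}) ∧
    -- (c) compact positive operators
    HasBPBpp {T : H →L[ℂ] H | IsCompactOperator T ∧ T.IsPositive} ∧
    -- (d) self-adjoint Schatten-von Neumann operators
    ((∀ p : ℝ, 1 ≤ p → HasBPBpp {T : H →L[ℂ] H | IsSelfAdjoint T ∧ T ∈ schattenClass H p}) ∧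
      HasBPBpp {T : H →L[ℂ] H | IsSelfAdjoint T ∧ T ∈ schattenOperators H}) ∧
    -- (e) normal Schatten-von Neumann operators
    ((∀ p : ℝ, 1 ≤ p → HasBPBpp {T : H →L[ℂ] H | IsStarNormal T ∧ T ∈ schattenClass H p}) ∧
      HasBPBpp {T : H →L[ℂ] H | IsStarNormal T ∧ T ∈ schattenOperators H}) := by
  have hpos : ∀ T ∈ {T : H →L[ℂ] H | T.IsPositive}, IsStarNormal T :=
    fun T hT ↦ hT.isSelfAdjoint.isStarNormal
  have hpos_conj : ∀ T ∈ {T : H →L[ℂ] H | T.IsPositive}, ∀ e : H ≃ₗᵢ[ℂ] H,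
      e.conjStarAlgEquiv T ∈ {T : H →L[ℂ] H | T.IsPositive} :=
    fun T hT e ↦ ContinuousLinearMap.IsPositive.conjStarAlgEquiv hT e
  have hpos_trunc : ∀ T ∈ {T : H →L[ℂ] H | T.IsPositive}, ∀ c : ℝ, 0 < c →
      radialTruncation c T ∈ {T : H →L[ℂ] H | T.IsPositive} :=
    fun T hT c hc ↦ isPositive_radialTruncation hc hT
  refine ⟨.of_isStarNormal hpos hpos_conj hpos_trunc, HasBPBpp.schatten hpos hpos_conj hpos_trunc,
    .of_isStarNormal (fun T hT ↦ hpos T hT.2)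
      (fun T hT e ↦ ⟨hT.1.conjStarAlgEquiv e, hpos_conj T hT.2 e⟩)
      (fun T hT c hc ↦ ⟨isCompactOperator_radialTruncation hc (hpos T hT.2) hT.1,
        hpos_trunc T hT.2 c hc⟩),
    HasBPBpp.schatten (P := {T | IsSelfAdjoint T}) (fun T hT ↦ IsSelfAdjoint.isStarNormal hT)
      (fun T hT e ↦ IsSelfAdjoint.map hT e.conjStarAlgEquiv)
      (fun T hT c _ ↦ isSelfAdjoint_radialTruncation c hT),
    HasBPBpp.schatten (P := {T | IsStarNormal T}) (fun T hT ↦ hT)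
      (fun T hT e ↦ haveI : IsStarNormal T := hT; IsStarNormal.map e.conjStarAlgEquiv T)
      (fun T _ c _ ↦ isStarNormal_radialTruncation c T)⟩
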